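/- Let $d\ge 1$, let $K\subset\mathbb R_+^d=\{x\in\mathbb R^d: x_j\ge 0 \text{ for all } j\}$ be a convex and compact set with nonempty interior in $\mathbb R^d$, and let $0<\varepsilon\le 1$. Then there exists an $\varepsilon$-approximate Pareto curve $A\subset K$, that is, a finite subset $A$ of $K$ such that for every $\theta=(\theta_1,\dots,\theta_d)\in K$ there is $\phi=(\phi_1,\dots,\phi_d)\in A$ with $\theta_j\le(1+\varepsilon)\phi_j$ for all $j\in\{1,\dots,d\}$, whose cardinality satisfies \[ |A|\le\left\lceil 8d\left(1+\frac1\varepsilon\right)^d\log\left(13\left(1+\frac1\varepsilon\right)^d\right)\right\rceil , \] where $\log$ is the natural logarithm. -/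

import Mathlib

/-- `A` is an `ε`-approximate Pareto curve for `K`: it is a subset of `K`, and every point of `K`
is dominated in every coordinate, up to the factor `1 + ε`, by one and the same point of `A`. -/
def IsApproxParetoCurve {d : ℕ} (ε : ℝ) (K A : Set (Fin d → ℝ)) : Prop :=
  A ⊆ K ∧ ∀ θ ∈ K, ∃ φ ∈ A, ∀ j : Fin d, θ j ≤ (1 + ε) * φ j

open MeasureTheory
open scoped Pointwise

/-! Cut the box spanned by the coordinate maxima of `K` into cells whose side is a fixed small
fraction `η` of each maximum. One point of `K` serves a whole cell if, scaled by `1 + ε`, it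
dominates the upper corner. By convexity such points contain a homothetic copy of `K`
(`pow_mul_volume_le_volume_dominating`): rounding a point of `K` up to its corner costs at most `η *
d` times a point `w` of `K` (`exists_mem_coord_ge_max_div`), and the rest of the slack `ε` leaves
room for the copy. So each of at most `(13 * p) ^ d` occupied cells, `p = (1 + 1 / ε) ^ d`, has a
serving set of volume share at least `1 / (3 * p)`, and greedy choice (`exists_finset_hitting`) hits
all these sets with few points. -/

/-- Some point of `K` lies in at least the average share of the sets `S i`. -/
theorem exists_mem_share_le_card {α ι : Type*} [MeasurableSpace α] {μ : Measure α} {K : Set α}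
    (h0 : μ K ≠ 0) (htop : μ K ≠ ⊤) (T : Finset ι) {S : ι → Set α} {q : ℝ}
    (hmeas : ∀ i ∈ T, MeasurableSet (S i)) (hsub : ∀ i ∈ T, S i ⊆ K)
    (hq : ∀ i ∈ T, q * μ.real K ≤ μ.real (S i)) :
    ∃ x ∈ K, q * T.card ≤ ∑ i ∈ T, (S i).indicator (fun _ => (1 : ℝ)) x := by
  have hint : ∀ i ∈ T, IntegrableOn ((S i).indicator (fun _ => (1 : ℝ))) K μ := fun i hi =>
    (integrableOn_const htop).indicator (hmeas i hi)
  obtain ⟨x, hx, hle⟩ := exists_setAverage_le h0 htop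
    (f := fun x => ∑ i ∈ T, (S i).indicator (fun _ => (1 : ℝ)) x)
    (integrable_finsetSum T hint)
  refine ⟨x, hx, le_trans ?_ hle⟩
  have hpos : 0 < μ.real K := ENNReal.toReal_pos h0 htop
  have hval : ∀ i ∈ T, ∫ x in K, (S i).indicator (fun _ => (1 : ℝ)) x ∂μ = μ.real (S i) := by
    intro i hi
    rw [integral_indicator (hmeas i hi), Measure.restrict_restrict (hmeas i hi),
      Set.inter_eq_left.2 (hsub i hi)]
    simp
  rw [setAverage_eq, integral_finsetSum T hint, Finset.sum_congr rfl hval, smul_eq_mul,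
    inv_mul_eq_div, le_div_iff₀ hpos]
  calc q * T.card * μ.real K = ∑ _i ∈ T, q * μ.real K := by simp; ring
    _ ≤ _ := Finset.sum_le_sum hq

/-- Greedy hitting sets: `N` points can be chosen in `K` that miss at most a `(1 - q) ^ N` share of
the sets `S i`, each of which fills at least a `q` share of `K`. -/
theorem exists_finset_card_unhit_le {α ι : Type*} [MeasurableSpace α] {μ : Measure α} {K : Set α}
    (h0 : μ K ≠ 0) (htop : μ K ≠ ⊤) (T : Finset ι) {S : ι → Set α} {q : ℝ} (hq1 : q ≤ 1)
    (hmeas : ∀ i ∈ T, MeasurableSet (S i)) (hsub : ∀ i ∈ T, S i ⊆ K)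
    (hq : ∀ i ∈ T, q * μ.real K ≤ μ.real (S i)) (N : ℕ) :
    ∃ A : Finset α, ∃ U ⊆ T, (A : Set α) ⊆ K ∧ A.card ≤ N ∧
      (∀ i ∈ T, i ∉ U → ∃ a ∈ A, a ∈ S i) ∧ (U.card : ℝ) ≤ (1 - q) ^ N * T.card := by
  classical
  induction N with
  | zero => exact ⟨∅, T, subset_rfl, by simp, by simp, fun i hi hn => absurd hi hn, by simp⟩
  | succ N ih =>
    obtain ⟨A, U, hUT, hAK, hA, hhit, hU⟩ := ih
    obtain ⟨x, hx, hle⟩ := exists_mem_share_le_card h0 htop U (fun i hi => hmeas i (hUT hi))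
      (fun i hi => hsub i (hUT hi)) (fun i hi => hq i (hUT hi))
    refine ⟨insert x A, U.filter (fun i => x ∉ S i), (Finset.filter_subset _ _).trans hUT, ?_,
      (Finset.card_insert_le _ _).trans (by omega), ?_, ?_⟩
    · rw [Finset.coe_insert]
      exact Set.insert_subset hx hAK
    · intro i hi hn
      by_cases hiU : i ∈ U
      · exact ⟨x, Finset.mem_insert_self _ _, by simpa [hiU] using hn⟩
      · obtain ⟨a, ha, has⟩ := hhit i hi hiU
        exact ⟨a, Finset.mem_insert_of_mem ha, has⟩
    · have hcount : ∑ i ∈ U, (S i).indicator (fun _ => (1 : ℝ)) x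
          = ((U.filter (fun i => x ∈ S i)).card : ℝ) := by
        simp [Set.indicator_apply]
      have hsplit : ((U.filter (fun i => x ∈ S i)).card : ℝ)
          + (U.filter (fun i => x ∉ S i)).card = U.card := by
        exact_mod_cast Finset.card_filter_add_card_filter_not (s := U) (fun i => x ∈ S i)
      calc ((U.filter (fun i => x ∉ S i)).card : ℝ) ≤ (1 - q) * U.card := by
            rw [hcount] at hle; linarith
        _ ≤ (1 - q) * ((1 - q) ^ N * T.card) :=
            mul_le_mul_of_nonneg_left hU (by linarith)
        _ = _ := by ring

/-- The number of missed sets is a natural number, so a bound below 1 leaves none. -/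
theorem exists_finset_hitting {α ι : Type*} [MeasurableSpace α] {μ : Measure α} {K : Set α}
    (h0 : μ K ≠ 0) (htop : μ K ≠ ⊤) (T : Finset ι) {S : ι → Set α} {q : ℝ} (hq1 : q ≤ 1)
    (hmeas : ∀ i ∈ T, MeasurableSet (S i)) (hsub : ∀ i ∈ T, S i ⊆ K)
    (hq : ∀ i ∈ T, q * μ.real K ≤ μ.real (S i)) {N : ℕ} (hN : (1 - q) ^ N * T.card < 1) :
    ∃ A : Finset α, (A : Set α) ⊆ K ∧ A.card ≤ N ∧ ∀ i ∈ T, ∃ a ∈ A, a ∈ S i := by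
  obtain ⟨A, U, -, hAK, hA, hhit, hU⟩ :=
    exists_finset_card_unhit_le h0 htop T hq1 hmeas hsub hq N
  have hU0 : U.card = 0 := by
    have : (U.card : ℝ) < 1 := hU.trans_lt hN
    exact Nat.lt_one_iff.1 (by exact_mod_cast this)
  rw [Finset.card_eq_zero] at hU0
  exact ⟨A, hAK, hA, fun i hi => hhit i hi (by simp [hU0])⟩

/-- A compact convex set in the nonnegative orthant contains a point each of whose coordinates is
at least a `1 / d` share of the largest value of that coordinate on the set. -/
theorem exists_mem_coord_ge_max_div {d : ℕ} (hd : 1 ≤ d) {K : Set (Fin d → ℝ)}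
    (hnonneg : ∀ x ∈ K, ∀ j, 0 ≤ x j) (hconv : Convex ℝ K) (hcomp : IsCompact K)
    (hne : K.Nonempty) :
    ∃ b : Fin d → ℝ, (∀ x ∈ K, ∀ j, x j ≤ b j) ∧ ∃ w ∈ K, ∀ j, b j ≤ d * w j := by
  have hmax : ∀ j : Fin d, ∃ y ∈ K, ∀ x ∈ K, x j ≤ y j := fun j =>
    hcomp.exists_isMaxOn hne (continuous_apply j).continuousOn
  choose y hy hymax using hmax
  have hd0 : (0 : ℝ) < d := by exact_mod_cast hd
  -- The witness is the barycentre of the `d` coordinate maximizers; by nonnegativity the other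
  -- terms of the average can be dropped.
  refine ⟨fun j => y j j, fun x hx j => hymax j x hx, ∑ i, (1 / (d : ℝ)) • y i,
    hconv.sum_mem (fun _ _ => by positivity) (by simp; field_simp) (fun i _ => hy i), fun j => ?_⟩
  have : y j j ≤ ∑ i, y i j :=
    Finset.single_le_sum (f := fun i => y i j) (fun i _ => hnonneg _ (hy i) j)
      (Finset.mem_univ j)
  simp only [Finset.sum_apply, Pi.smul_apply, smul_eq_mul, ← Finset.mul_sum]
  calc y j j ≤ ∑ i, y i j := this
    _ = _ := by field_simp

theorem volume_real_image_add_smul {d : ℕ} (v : Fin d → ℝ) {c : ℝ} (hc : 0 ≤ c)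
    (K : Set (Fin d → ℝ)) :
    volume.real ((fun x => v + c • x) '' K) = c ^ d * volume.real K := by
  have h : (fun x => v + c • x) '' K = (fun x => v + x) '' (c • K) := by
    rw [← Set.image_smul, Set.image_image]
  rw [h, measureReal_def, Set.image_add_left, measure_preimage_add, Measure.addHaar_smul]
  simp [abs_of_nonneg (pow_nonneg hc d), ENNReal.toReal_ofReal (pow_nonneg hc d), measureReal_def]

/-- The part of `K` that dominates `u / (1 + ε)` contains a homothetic copy of `K` if `u` exceeds a
point of `K` by at most `t` times another one. -/
theorem pow_mul_volume_le_volume_dominating {d : ℕ} {K : Set (Fin d → ℝ)}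
    (hnonneg : ∀ x ∈ K, ∀ j, 0 ≤ x j) (hconv : Convex ℝ K) (htop : volume K ≠ ⊤)
    {ε t : ℝ} (ht : 0 ≤ t) (htε : t ≤ ε) {θ w u : Fin d → ℝ} (hθ : θ ∈ K) (hw : w ∈ K)
    (hu : ∀ j, u j ≤ θ j + t * w j) :
    ((ε - t) / (1 + ε)) ^ d * volume.real K
      ≤ volume.real {x | x ∈ K ∧ ∀ j, u j ≤ (1 + ε) * x j} := by
  have hε : 0 < 1 + ε := by linarith
  have hs : 0 ≤ ε - t := by linarith
  -- The copy consists of the points `(θ + t w + (ε - t) z) / (1 + ε)` with `z ∈ K`, convex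
  -- combinations because `1 + t + (ε - t) = 1 + ε`.
  rw [← volume_real_image_add_smul ((1 / (1 + ε)) • θ + (t / (1 + ε)) • w) (by positivity) K]
  refine measureReal_mono ?_ (ne_top_of_le_ne_top htop (measure_mono fun x hx => hx.1))
  rintro _ ⟨z, hz, rfl⟩
  refine ⟨?_, fun j => ?_⟩
  · have hmem := hconv.sum_mem (t := Finset.univ)
      (w := ![1 / (1 + ε), t / (1 + ε), (ε - t) / (1 + ε)]) (z := ![θ, w, z])
      (by intro i _; fin_cases i <;> simp <;> positivity)
      (by simp [Fin.sum_univ_three]; field_simp; ring)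
      (by intro i _; fin_cases i <;> simp [hθ, hw, hz])
    simpa [Fin.sum_univ_three] using hmem
  · have hz0 := mul_nonneg hs (hnonneg z hz j)
    simp only [Pi.add_apply, Pi.smul_apply, smul_eq_mul]
    have : (1 + ε) * (1 / (1 + ε) * θ j + t / (1 + ε) * w j + (ε - t) / (1 + ε) * z j)
        = θ j + t * w j + (ε - t) * z j := by field_simp
    rw [this]
    linarith [hu j]

theorem mul_succ_le_mul_two_pow (n : ℕ) : (n + 1) * (n + 2) ≤ 13 * 2 ^ n := by
  induction n with
  | zero => norm_num
  | succ n ih =>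
    rw [pow_succ]
    rcases n with _ | _ | n
    · norm_num
    · norm_num
    · nlinarith

theorem grid_card_le {d : ℕ} (hd : 1 ≤ d) {ε : ℝ} (hε : 0 < ε) (hε1 : ε ≤ 1) :
    (d : ℝ) * (d + 1) / ε + 1 ≤ 13 * (1 + 1 / ε) ^ d := by
  obtain ⟨n, rfl⟩ : ∃ n, d = n + 1 := ⟨d - 1, by omega⟩
  have h1 : (1 : ℝ) ≤ 1 / ε := by rw [le_div_iff₀ hε]; linarith
  have h2 : (2 : ℝ) ^ n ≤ (1 + 1 / ε) ^ n := pow_le_pow_left₀ (by norm_num) (by linarith) n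
  have h3 : ((n : ℝ) + 1) * (n + 2) ≤ 13 * 2 ^ n := by exact_mod_cast mul_succ_le_mul_two_pow n
  have h4 : (1 : ℝ) ≤ 2 ^ n := one_le_pow₀ (by norm_num)
  calc ((n + 1 : ℕ) : ℝ) * ((n + 1 : ℕ) + 1) / ε + 1
      = ((n : ℝ) + 1) * (n + 2) * (1 / ε) + 1 := by push_cast; ring
    _ ≤ 13 * 2 ^ n * (1 / ε) + 13 * 2 ^ n := by
        gcongr; linarith
    _ = 13 * (2 ^ n * (1 + 1 / ε)) := by ring
    _ ≤ 13 * ((1 + 1 / ε) ^ n * (1 + 1 / ε)) := by gcongr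
    _ = _ := by rw [pow_succ]

/-- The reciprocal is `(1 + 1 / d) ^ d ≤ e < 3`. -/
theorem one_third_le_div_succ_pow (d : ℕ) : (1 / 3 : ℝ) ≤ ((d : ℝ) / (d + 1)) ^ d := by
  rcases Nat.eq_zero_or_pos d with rfl | hd
  · norm_num
  have hd0 : (0 : ℝ) < d := by exact_mod_cast hd
  have h : (((d : ℝ) + 1) / d) ^ d ≤ 3 := by
    calc (((d : ℝ) + 1) / d) ^ d ≤ (Real.exp (1 / d)) ^ d := by
          refine pow_le_pow_left₀ (by positivity) ?_ d
          have := Real.add_one_le_exp (1 / (d : ℝ))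
          rw [add_div, div_self hd0.ne']
          linarith
      _ = Real.exp 1 := by rw [← Real.exp_nat_mul]; congr 1; field_simp
      _ ≤ 3 := Real.exp_one_lt_three.le
  rw [← inv_div ((d : ℝ) + 1), inv_pow, one_div]
  exact inv_anti₀ (by positivity) h

theorem theorem6 (d : ℕ) (hd : 1 ≤ d) (K : Set (Fin d → ℝ))
    (hK_nonneg : ∀ x ∈ K, ∀ j : Fin d, 0 ≤ x j)
    (hK_convex : Convex ℝ K) (hK_compact : IsCompact K) (hK_int : (interior K).Nonempty)
    (ε : ℝ) (hε_pos : 0 < ε) (hε_le : ε ≤ 1) :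
    ∃ A : Finset (Fin d → ℝ), IsApproxParetoCurve ε K (A : Set (Fin d → ℝ)) ∧
      A.card ≤ ⌈8 * (d : ℝ) * (1 + 1 / ε) ^ d * Real.log (13 * (1 + 1 / ε) ^ d)⌉₊ := by
  classical
  set N := ⌈8 * (d : ℝ) * (1 + 1 / ε) ^ d * Real.log (13 * (1 + 1 / ε) ^ d)⌉₊ with hN
  have hd0 : (0 : ℝ) < d := by exact_mod_cast hd
  have h0 : volume K ≠ 0 := (Measure.measure_pos_of_nonempty_interior _ hK_int).ne'
  have htop : volume K ≠ ⊤ := hK_compact.measure_lt_top.ne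
  obtain ⟨b, hb, w, hw, hbw⟩ := exists_mem_coord_ge_max_div hd hK_nonneg hK_convex hK_compact
    (hK_int.mono interior_subset)
  -- Rounding up then uses `η * d = ε / (d + 1)` of the slack, so the copy of `K` shrinks only by a
  -- further factor `d / (d + 1)`, costing at most a factor 3 in volume.
  set η : ℝ := ε / (d * (d + 1)) with hη
  have hη0 : 0 < η := by positivity
  let g : (Fin d → ℝ) → Fin d → ℕ := fun θ j => ⌊θ j / (η * b j)⌋₊
  let S : (Fin d → ℕ) → Set (Fin d → ℝ) :=
    fun k => {x | x ∈ K ∧ ∀ j, ((k j : ℝ) + 1) * (η * b j) ≤ (1 + ε) * x j}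
  -- The extra 1 admits the index `⌊1 / η⌋₊`, reached when `θ j = b j`.
  let M : ℕ := ⌊1 / η⌋₊ + 1
  let T : Finset (Fin d → ℕ) :=
    (Fintype.piFinset fun _ => Finset.range M).filter fun k => ∃ θ ∈ K, g θ = k
  have hb0 : ∀ θ ∈ K, ∀ j, 0 ≤ b j := fun θ hθ j => (hK_nonneg θ hθ j).trans (hb θ hθ j)
  have hgT : ∀ θ ∈ K, g θ ∈ T := by
    intro θ hθ
    refine Finset.mem_filter.2 ⟨Fintype.mem_piFinset.2 fun j => Finset.mem_range.2 ?_, θ, hθ, rfl⟩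
    refine Nat.lt_succ_of_le (Nat.floor_le_floor ?_)
    rw [mul_comm, ← div_div]
    exact div_le_div_of_nonneg_right (div_le_one_of_le₀ (hb θ hθ j) (hb0 θ hθ j)) hη0.le
  have hup : ∀ θ ∈ K, ∀ j, θ j ≤ ((g θ j : ℝ) + 1) * (η * b j) := by
    intro θ hθ j
    -- If `b j = 0`, the cell has zero width and `θ j ≤ b j` already suffices; the floor estimate
    -- needs positive width.
    rcases (hb0 θ hθ j).eq_or_lt with h | h
    · rw [← h]; simpa [← h] using hb θ hθ j
    · have := Nat.lt_floor_add_one (θ j / (η * b j))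
      rw [div_lt_iff₀ (by positivity)] at this
      exact this.le
  have hlow : ∀ θ ∈ K, ∀ j, ((g θ j : ℝ) + 1) * (η * b j) ≤ θ j + η * d * w j := by
    intro θ hθ j
    have h1 : (g θ j : ℝ) * (η * b j) ≤ θ j := by
      have hnn := mul_nonneg hη0.le (hb0 θ hθ j)
      exact mul_le_of_le_div₀ (hK_nonneg θ hθ j) hnn
        (Nat.floor_le (div_nonneg (hK_nonneg θ hθ j) hnn))
    nlinarith [mul_le_mul_of_nonneg_left (hbw j) hη0.le]
  have hεη : η * d = ε / (d + 1) := by rw [hη]; field_simp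
  set p : ℝ := (1 + 1 / ε) ^ d with hp
  have hp1 : 1 ≤ p := one_le_pow₀ (by have : 0 < 1 / ε := by positivity
                                      linarith)
  have hq : ∀ k ∈ T, 1 / (3 * p) * volume.real K ≤ volume.real (S k) := by
    intro k hk
    obtain ⟨-, θ, hθ, rfl⟩ := Finset.mem_filter.1 hk
    refine le_trans ?_ (pow_mul_volume_le_volume_dominating hK_nonneg hK_convex htop
      (t := η * d) (by positivity) ?_ hθ hw (hlow θ hθ))
    · refine mul_le_mul_of_nonneg_right ?_ measureReal_nonneg
      have : (ε - η * d) / (1 + ε) = d / (d + 1) * (1 + 1 / ε)⁻¹ := by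
        rw [hεη]; field_simp; ring
      rw [this, mul_pow, inv_pow, ← hp]
      calc 1 / (3 * p) = 1 / 3 * p⁻¹ := by rw [one_div_mul_eq_div, one_div, mul_inv]; ring
        _ ≤ _ := by gcongr; exact one_third_le_div_succ_pow d
    · rw [hεη]
      exact div_le_self hε_pos.le (by linarith)
  have hmeas : ∀ k ∈ T, MeasurableSet (S k) := by
    intro k _
    refine (hK_compact.isClosed.inter (s₂ := {x | ∀ j, _}) ?_).measurableSet
    simp only [Set.ofPred_forall]
    exact isClosed_iInter fun j => isClosed_le continuous_const (by fun_prop)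
  have hTcard : (T.card : ℝ) ≤ (13 * p) ^ d := by
    have h1 : T.card ≤ M ^ d := (Finset.card_filter_le _ _).trans (by simp)
    have h2 : (M : ℝ) ≤ 13 * p := by
      refine le_trans ?_ (grid_card_le hd hε_pos hε_le)
      have := Nat.floor_le (a := 1 / η) (by positivity)
      have h3 : 1 / η = d * (d + 1) / ε := by rw [hη, one_div_div]
      simp only [M, Nat.cast_add, Nat.cast_one]
      linarith
    calc (T.card : ℝ) ≤ (M : ℝ) ^ d := by exact_mod_cast h1
      _ ≤ _ := pow_le_pow_left₀ (by positivity) h2 d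
  have hL : 0 < Real.log (13 * p) := Real.log_pos (by linarith)
  have hlt : (1 - 1 / (3 * p)) ^ N * T.card < 1 := by
    have hle : 1 / (3 * p) ≤ 1 := by rw [div_le_one (by positivity)]; linarith
    have hexp : (1 - 1 / (3 * p)) ^ N ≤ Real.exp (-(N * (1 / (3 * p)))) := by
      calc (1 - 1 / (3 * p)) ^ N ≤ Real.exp (-(1 / (3 * p))) ^ N :=
            pow_le_pow_left₀ (by linarith) (Real.one_sub_le_exp_neg _) N
        _ = _ := by rw [← Real.exp_nat_mul]; congr 1; ring
    have hcard : (T.card : ℝ) ≤ Real.exp (d * Real.log (13 * p)) := by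
      rwa [Real.exp_nat_mul, Real.exp_log (by linarith)]
    -- The 8 in `N` over the 3 in the volume share gives `8 / 3`; any factor above 1 would beat the
    -- `d * log (13 * p)` coming from the cell count.
    have hNle : 8 / 3 * (d * Real.log (13 * p)) ≤ N * (1 / (3 * p)) := by
      rw [mul_one_div, le_div_iff₀ (by positivity)]
      calc _ = 8 * (d : ℝ) * p * Real.log (13 * p) := by ring
        _ ≤ N := Nat.le_ceil _
    have hdL : 0 < d * Real.log (13 * p) := mul_pos hd0 hL
    calc (1 - 1 / (3 * p)) ^ N * T.card
        ≤ Real.exp (-(N * (1 / (3 * p)))) * Real.exp (d * Real.log (13 * p)) :=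
          mul_le_mul hexp hcard (by positivity) (Real.exp_pos _).le
      _ = Real.exp (-(N * (1 / (3 * p))) + d * Real.log (13 * p)) := (Real.exp_add _ _).symm
      _ < 1 := Real.exp_lt_one_iff.2 (by linarith)
  obtain ⟨A, hAK, hA, hhit⟩ := exists_finset_hitting h0 htop T
    (by rw [div_le_one (by positivity)]; linarith) hmeas (fun k _ x hx => hx.1) hq hlt
  refine ⟨A, ⟨hAK, fun θ hθ => ?_⟩, hA⟩
  obtain ⟨φ, hφ, hφS⟩ := hhit (g θ) (hgT θ hθ)
  exact ⟨φ, hφ, fun j => (hup θ hθ j).trans (hφS.2 j)⟩
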